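/- Let $0\le\alpha$, $0<\Delta\beta\le\beta\le\pi/4$, $\Delta\alpha\ge 0$, $\alpha+\Delta\alpha\le\pi/4$, and suppose that $$H[\cos^2\beta]+H[\cos^2\alpha]=H[\cos^2(\beta-\Delta\beta)]+H[\cos^2(\alpha+\Delta\alpha)],\qquad H[x]=-x\log_2x-(1-x)\log_2(1-x).$$ For an angle $\theta$ and orthonormal bases $\{|\mu\rangle,|\mu^\perp\rangle\}$, $\{|\nu\rangle,|\nu^\perp\rangle\}$ of two qubits consider the two-qubit state $\cos\theta\,|\mu\rangle|\nu\rangle+\sin\theta\,|\mu^\perp\rangle|\nu^\perp\rangle$. Let the donor state $|\psi_\beta\rangle_{AB}$ and the acceptor state $|\phi_\alpha\rangle_{ab}$ be such states with angles $\beta$ and $\alpha$, and let $|\psi_{\beta-\Delta\beta}\rangle_{AB}$ and $|\phi_{\alpha+\Delta\alpha}\rangle_{ab}$ be such states with angles $\beta-\Delta\beta$ and $\alpha+\Delta\alpha$; the local bases of the four states are arbitrary. One party holds the qubits $A,a$ and the other party holds $B,b$. Let $E$ denote the entropy of entanglement (the von Neumann entropy, in bits, of a reduced state). (1) There is a protocol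 of finitely many rounds of local operations and classical communication (LOCC) between the two parties which transforms $|\psi_\beta\rangle_{AB}\otimes|\phi_\alpha\rangle_{ab}$ with certainty into $|\psi_{\beta-\Delta\beta}\rangle_{AB}\otimes|\phi_{\alpha+\Delta\alpha}\rangle_{ab}$ if and only if $\alpha=\beta-\Delta\beta$. (2) If $\alpha=\beta-\Delta\beta$, then $\Delta\alpha=\Delta\beta$; the transferred entanglement $\Delta E=E(\psi_\beta)-E(\psi_{\beta-\Delta\beta})=E(\phi_{\alpha+\Delta\alpha})-E(\phi_\alpha)$ equals $E(\psi_\beta)-E(\phi_\alpha)$; and the transfer is the local swap: the swaps $A\leftrightarrow a$ and $B\leftrightarrow b$ turn $|\psi_\beta\rangle_{AB}\otimes|\phi_\alpha\rangle_{ab}$ into the product, over $AB$ and $ab$, of the state with angle $\beta-\Delta\beta$ in the bases of $|\phi_\alpha\rangle$ and the state with angle $\alpha+\Delta\alpha$ in the bases of $|\psi_\beta\rangle$, and one-qubit unitaries on $A,a,B,b$ turn that product into $|\psi_{\beta-\Delta\beta}\rangle_{AB}\otimes|\phi_{\alpha+\Delta\alpha}\rangle_{ab}$. -/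

import Mathlib

open scoped Kronecker

/-- The Shannon entropy, in bits, of the probability distribution `{x, 1 - x}`. -/
noncomputable def shannonH (x : ℝ) : ℝ :=
  -x * Real.logb 2 x - (1 - x) * Real.logb 2 (1 - x)

/-- The density matrix `|v⟩⟨v|` of the pure state with amplitudes `v`. -/
def pureDensity {X : Type} (v : X → ℂ) : Matrix X X ℂ :=
  Matrix.vecMulVec v (star v)

/-- The reduced state on the first tensor factor (the second factor is traced out). -/
def reducedState {A B : Type} [Fintype B] (ρ : Matrix (A × B) (A × B) ℂ) : Matrix A A ℂ :=
  Matrix.of fun a a' => ∑ b, ρ (a, b) (a', b)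

/-- The von Neumann entropy in bits: the sum of `-x log₂ x` over the eigenvalues `x` of `ρ`,
counted with multiplicity (they are real when `ρ` is a density matrix). -/
noncomputable def vonNeumannEntropy {A : Type} [Fintype A] [DecidableEq A]
    (ρ : Matrix A A ℂ) : ℝ :=
  (ρ.charpoly.roots.map fun z => -z.re * Real.logb 2 z.re).sum

/-- The entropy of entanglement of a bipartite pure state. -/
noncomputable def entanglement {A B : Type} [Fintype A] [DecidableEq A] [Fintype B]
    (v : A × B → ℂ) : ℝ :=
  vonNeumannEntropy (reducedState (pureDensity v))

/-- The orthonormal bases of the state space of one qubit. -/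
abbrev QubitBasis : Type := OrthonormalBasis (Fin 2) ℂ (EuclideanSpace ℂ (Fin 2))

/-- The two-qubit state `cos θ |μ⟩|ν⟩ + sin θ |μ^⊥⟩|ν^⊥⟩`, where `|μ⟩, |μ^⊥⟩` and `|ν⟩, |ν^⊥⟩` are
orthonormal bases of the two qubits. -/
noncomputable def schmidtState (θ : ℝ) (μ ν : QubitBasis) : Fin 2 × Fin 2 → ℂ := fun x =>
  (Real.cos θ : ℂ) * (μ 0 x.1 * ν 0 x.2) + (Real.sin θ : ℂ) * (μ 1 x.1 * ν 1 x.2)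

/-- The product `ψ_{AB} ⊗ φ_{ab}`, seen as a bipartite state: `A, a` are on the first side and
`B, b` on the second. -/
def jointState {A B a b : Type} (ψ : A × B → ℂ) (φ : a × b → ℂ) : (A × a) × (B × b) → ℂ :=
  fun x => ψ (x.1.1, x.2.1) * φ (x.1.2, x.2.2)

/-- Both sides locally swap their two particles: `A ↔ a` and `B ↔ b`. -/
def localSwap {P Q : Type} (v : (P × P) × (Q × Q) → ℂ) : (P × P) × (Q × Q) → ℂ :=
  fun x => v (x.1.swap, x.2.swap)

/-- A (finite) LOCC protocol which starts with local systems `A`, `B` and ends with local systems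
`A'`, `B'`; a finite type stands for the Hilbert space which has it as its standard basis.
In every round one side performs a generalized measurement with Kraus operators `M i` on its own
system, possibly with a new output system (this includes unitaries, randomization, adding
and discarding ancillas), and announces the outcome `i`; the rest of the protocol may depend
on all the outcomes obtained so far. -/
inductive LOCCProtocol (A' B' : Type) : Type → Type → Type 1
  | done : LOCCProtocol A' B' A' B'
  | alice {A B A₁ : Type} [Fintype A] [DecidableEq A] [Fintype B] [DecidableEq B] [Fintype A₁]
      {k : ℕ} (M : Fin k → Matrix A₁ A ℂ) (hM : ∑ i, (M i).conjTranspose * M i = 1)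
      (next : Fin k → LOCCProtocol A' B' A₁ B) : LOCCProtocol A' B' A B
  | bob {A B B₁ : Type} [Fintype A] [DecidableEq A] [Fintype B] [DecidableEq B] [Fintype B₁]
      {k : ℕ} (M : Fin k → Matrix B₁ B ℂ) (hM : ∑ i, (M i).conjTranspose * M i = 1)
      (next : Fin k → LOCCProtocol A' B' A B₁) : LOCCProtocol A' B' A B

/-- The output density matrix of a protocol, i.e. the average of the final states over all
measurement records. -/
noncomputable def LOCCProtocol.run {A' B' : Type} : {A B : Type} → LOCCProtocol A' B' A B →
    Matrix (A × B) (A × B) ℂ → Matrix (A' × B') (A' × B') ℂ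
  | _, _, .done, ρ => ρ
  | _, _, @LOCCProtocol.alice _ _ _ B _ _ _ _ _ _ _ M _ next, ρ => ∑ i, (next i).run
      ((M i ⊗ₖ (1 : Matrix B B ℂ)) * ρ * (M i ⊗ₖ (1 : Matrix B B ℂ)).conjTranspose)
  | _, _, @LOCCProtocol.bob _ _ A _ _ _ _ _ _ _ _ M _ next, ρ => ∑ i, (next i).run
      (((1 : Matrix A A ℂ) ⊗ₖ M i) * ρ * ((1 : Matrix A A ℂ) ⊗ₖ M i).conjTranspose)

/-- The pure state `v` can be transformed into the pure state `w` reliably, i.e. with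
certainty, by LOCC. -/
def LOCCConvertible {A B A' B' : Type} (v : A × B → ℂ) (w : A' × B' → ℂ) : Prop :=
  ∃ P : LOCCProtocol A' B' A B, P.run (pureDensity v) = pureDensity w

/-! Write a bipartite pure state as its amplitude matrix `V`. The largest weight `frobeniusSq (V *
Q)` over projections `Q` of rank at most `k` is the sum of the `k` largest squared Schmidt
coefficients, and on average LOCC cannot decrease it (`LOCCProtocol.exists_ensemble`). A pure target
is an extreme point, so every branch of an exact conversion ends in a multiple of it, and the
weights of source and target can be compared directly (`LOCCConvertible.frobeniusSq_mul_le`).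

Put x = cos² β, y = cos² α, x' = cos² (β - Δβ), y' = cos² (α + Δα), all in [1/2, 1], with x < x' and
y' ≤ y. Rank one gives x y ≤ x' y', and rank two gives y ≤ max x' y'
(`LOCCConvertible.cos_sq_majorized`). Entropy balance forces y' < y, hence y ≤ x'. If y < x', the
pair {x', y'} is a strict spread of {x, y} with the same total entropy. The binary entropy is
strictly concave and decreasing in the logarithm of its argument, so such a spread lowers the
product (`mul_lt_mul_of_binEntropy_add_eq`), contradicting rank one. So y = x', that is α = β - Δβ.

Conversely, if α = β - Δβ, balance and injectivity of the entropy on [1/2, 1] give α + Δα = β. The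
two pairs merely exchange their angles, which a local swap and a change of local bases achieve. -/

namespace Matrix

/-! ### Frobenius norms and projections of bounded rank. -/

/-- The squared Frobenius norm, as a trace. -/
noncomputable def frobeniusSq {A B : Type} [Fintype A] [Fintype B] (M : Matrix A B ℂ) : ℝ :=
  (Mᴴ * M).trace.re

section frobeniusSq

variable {A B C : Type} [Fintype A] [Fintype B] [Fintype C]

theorem frobeniusSq_eq_sum (M : Matrix A B ℂ) :
    frobeniusSq M = ∑ a, ∑ b, Complex.normSq (M a b) := by
  rw [Finset.sum_comm]
  simp [frobeniusSq, Matrix.trace, Matrix.mul_apply, Complex.normSq_apply]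

theorem frobeniusSq_nonneg (M : Matrix A B ℂ) : 0 ≤ frobeniusSq M := by
  rw [frobeniusSq_eq_sum]
  exact Finset.sum_nonneg fun _ _ => Finset.sum_nonneg fun _ _ => Complex.normSq_nonneg _

theorem frobeniusSq_conjTranspose (M : Matrix A B ℂ) : frobeniusSq Mᴴ = frobeniusSq M := by
  rw [frobeniusSq, frobeniusSq, Matrix.conjTranspose_conjTranspose, Matrix.trace_mul_comm]

theorem frobeniusSq_transpose (M : Matrix A B ℂ) : frobeniusSq Mᵀ = frobeniusSq M := by
  rw [frobeniusSq_eq_sum, frobeniusSq_eq_sum, Finset.sum_comm]; rfl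

theorem frobeniusSq_smul (c : ℂ) (M : Matrix A B ℂ) :
    frobeniusSq (c • M) = Complex.normSq c * frobeniusSq M := by
  simp [frobeniusSq_eq_sum, Finset.mul_sum]

/-- Conservation of probability: the completeness relation can be inserted between `Mᴴ` and `M`
under the trace. -/
theorem sum_frobeniusSq_mul {ι : Type} [Fintype ι] [DecidableEq A] {D : ι → Type}
    [∀ i, Fintype (D i)] (K : ∀ i, Matrix (D i) A ℂ) (hK : ∑ i, (K i)ᴴ * K i = 1)
    (M : Matrix A B ℂ) : ∑ i, frobeniusSq (K i * M) = frobeniusSq M := by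
  have h : Mᴴ * M = ∑ i, (K i * M)ᴴ * (K i * M) := by
    calc Mᴴ * M = Mᴴ * (∑ i, (K i)ᴴ * K i) * M := by rw [hK, Matrix.mul_one]
      _ = _ := by
        simp only [Matrix.mul_sum, Matrix.sum_mul, Matrix.conjTranspose_mul, Matrix.mul_assoc]
  simp only [frobeniusSq]
  rw [h, Matrix.trace_sum, Complex.re_sum]

theorem frobeniusSq_isometry_mul [DecidableEq A] (K : Matrix C A ℂ) (hK : Kᴴ * K = 1)
    (M : Matrix A B ℂ) : frobeniusSq (K * M) = frobeniusSq M := by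
  simpa using sum_frobeniusSq_mul (fun _ : Unit => K) (by simpa using hK) M

/-- An orthogonal projection of rank at most `k`. -/
structure IsProjOfRankLE (k : ℕ) (Q : Matrix A A ℂ) : Prop where
  isHermitian : Qᴴ = Q
  mul_self : Q * Q = Q
  rank_le : Q.rank ≤ k

/-- Pythagoras for the splitting of `M` into `M * Q` and `M * (1 - Q)`. -/
theorem frobeniusSq_mul_le {k : ℕ} {Q : Matrix B B ℂ} (hQ : IsProjOfRankLE k Q)
    (M : Matrix A B ℂ) : frobeniusSq (M * Q) ≤ frobeniusSq M := by
  classical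
  have h := frobeniusSq_nonneg (M * (1 - Q))
  have e : frobeniusSq (M * (1 - Q)) = frobeniusSq M - frobeniusSq (M * Q) := by
    rw [← frobeniusSq_conjTranspose (M * (1 - Q)), ← frobeniusSq_conjTranspose M,
      ← frobeniusSq_conjTranspose (M * Q)]
    have e1 : M * (1 - Q) * (M * (1 - Q))ᴴ = M * Mᴴ - M * Q * Mᴴ := by
      rw [Matrix.conjTranspose_mul, Matrix.conjTranspose_sub, hQ.isHermitian,
        Matrix.conjTranspose_one, Matrix.mul_assoc, ← Matrix.mul_assoc (1 - Q)]
      have : (1 - Q) * (1 - Q) = 1 - Q := by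
        simp [Matrix.mul_sub, Matrix.sub_mul, hQ.mul_self]
      rw [this]
      simp [Matrix.mul_sub, Matrix.sub_mul, Matrix.mul_assoc]
    have e2 : M * Q * (M * Q)ᴴ = M * Q * Mᴴ := by
      rw [Matrix.conjTranspose_mul, hQ.isHermitian, Matrix.mul_assoc, ← Matrix.mul_assoc Q,
        hQ.mul_self, ← Matrix.mul_assoc]
    simp only [frobeniusSq, Matrix.conjTranspose_conjTranspose]
    rw [e1, e2, Matrix.trace_sub, Complex.sub_re]
  linarith

/-- The orthogonal projection onto the column space of `Y`. -/
theorem exists_isProjOfRankLE_mul_eq (Y : Matrix A C ℂ) :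
    ∃ P : Matrix A A ℂ, IsProjOfRankLE Y.rank P ∧ P * Y = Y := by
  classical
  let e := Matrix.toEuclideanCLM (n := A) (𝕜 := ℂ)
  let W : Submodule ℂ (EuclideanSpace ℂ A) :=
    (LinearMap.range Y.mulVecLin).map (WithLp.linearEquiv 2 ℂ (A → ℂ)).symm.toLinearMap
  have hmem : ∀ x, WithLp.toLp 2 (Y *ᵥ x) ∈ W := fun x =>
    Submodule.mem_map_of_mem (f := (WithLp.linearEquiv 2 ℂ (A → ℂ)).symm.toLinearMap)
      (LinearMap.mem_range_self Y.mulVecLin x)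
  let P := e.symm W.starProjection
  have einj : Function.Injective e := EquivLike.injective e
  have heP : e P = W.starProjection := e.apply_symm_apply _
  have hact : ∀ x : A → ℂ, P *ᵥ x = (W.starProjection (WithLp.toLp 2 x)).ofLp := by
    intro x
    rw [← heP]
    exact (Matrix.ofLp_toEuclideanCLM P (WithLp.toLp 2 x)).symm
  have hY : P * Y = Y := by
    apply Matrix.toLin'.injective
    ext1 j
    ext1
    simp only [LinearMap.comp_apply, Matrix.toLin'_apply]
    rw [← Matrix.mulVec_mulVec, hact, Submodule.starProjection_eq_self_iff.2 (hmem _)]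
  refine ⟨P, ⟨?_, ?_, ?_⟩, hY⟩
  · apply einj
    have : e Pᴴ = star (e P) := map_star e P
    rw [this, heP]
    exact (isSelfAdjoint_starProjection W)
  · apply einj
    rw [map_mul, heP]
    exact W.isIdempotentElem_starProjection
  · have hP : LinearMap.range P.mulVecLin ≤ LinearMap.range Y.mulVecLin := by
      rintro _ ⟨x, rfl⟩
      rw [Matrix.mulVecLin_apply, hact]
      obtain ⟨y, hy, hy'⟩ := W.starProjection_apply_mem (WithLp.toLp 2 x)
      rw [← hy']
      exact hy
    exact Submodule.finrank_mono hP

/-- Let `P` project onto the column space of `V * Q`, whose rank is at most that of `Q`. Then `V * Q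
= P * V * Q`, and dropping `Q` only increases the norm. This moves a projection from one party to
the other without losing weight. -/
theorem exists_frobeniusSq_mul_le_left {k : ℕ} {Q : Matrix B B ℂ} (hQ : IsProjOfRankLE k Q)
    (V : Matrix A B ℂ) : ∃ P : Matrix A A ℂ, IsProjOfRankLE k P ∧
      frobeniusSq (V * Q) ≤ frobeniusSq (P * V) := by
  obtain ⟨P, hP, hPV⟩ := exists_isProjOfRankLE_mul_eq (V * Q)
  refine ⟨P, ⟨hP.isHermitian, hP.mul_self, hP.rank_le.trans
    ((Matrix.rank_mul_le_right _ _).trans hQ.rank_le)⟩, ?_⟩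
  rw [← hPV, ← Matrix.mul_assoc]
  exact frobeniusSq_mul_le hQ _

theorem exists_frobeniusSq_mul_le_right {k : ℕ} {P : Matrix A A ℂ} (hP : IsProjOfRankLE k P)
    (V : Matrix A B ℂ) : ∃ Q : Matrix B B ℂ, IsProjOfRankLE k Q ∧
      frobeniusSq (P * V) ≤ frobeniusSq (V * Q) := by
  obtain ⟨Q, hQ, h⟩ := exists_frobeniusSq_mul_le_left hP Vᴴ
  refine ⟨Q, hQ, ?_⟩
  rw [← frobeniusSq_conjTranspose (P * V), ← frobeniusSq_conjTranspose (V * Q),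
    Matrix.conjTranspose_mul, Matrix.conjTranspose_mul, hP.isHermitian, hQ.isHermitian]
  exact h

/-- Read off the diagonal of `Q = Q * Qᴴ`. It follows that the diagonal entries lie in [0, 1]; as
their sum is the rank, they act as the weights of a linear program. -/
theorem IsProjOfRankLE.diag_eq_normSq {k : ℕ} {Q : Matrix A A ℂ} (hQ : IsProjOfRankLE k Q)
    (i : A) : Q i i = ((∑ j, Complex.normSq (Q i j) : ℝ) : ℂ) := by
  conv_lhs => rw [← hQ.mul_self, Matrix.mul_apply]
  push_cast
  refine Finset.sum_congr rfl fun j _ => ?_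
  rw [← Complex.mul_conj]
  congr 1
  exact (congrFun (congrFun hQ.isHermitian j) i).symm

theorem IsProjOfRankLE.diag_nonneg {k : ℕ} {Q : Matrix A A ℂ} (hQ : IsProjOfRankLE k Q)
    (i : A) : 0 ≤ (Q i i).re := by
  rw [hQ.diag_eq_normSq, Complex.ofReal_re]
  exact Finset.sum_nonneg fun _ _ => Complex.normSq_nonneg _

theorem IsProjOfRankLE.diag_le_one {k : ℕ} {Q : Matrix A A ℂ} (hQ : IsProjOfRankLE k Q)
    (i : A) : (Q i i).re ≤ 1 := by
  have h := hQ.diag_eq_normSq i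
  have h1 : Complex.normSq (Q i i) ≤ ∑ j, Complex.normSq (Q i j) :=
    Finset.single_le_sum (f := fun j => Complex.normSq (Q i j))
      (fun _ _ => Complex.normSq_nonneg _) (Finset.mem_univ i)
  have h2 : (Q i i).re * (Q i i).re ≤ Complex.normSq (Q i i) := by
    rw [Complex.normSq_apply]; nlinarith [mul_self_nonneg (Q i i).im]
  have h3 : (Q i i).re = ∑ j, Complex.normSq (Q i j) := by rw [h, Complex.ofReal_re]
  nlinarith

theorem IsProjOfRankLE.sum_diag_le {k : ℕ} {Q : Matrix A A ℂ} (hQ : IsProjOfRankLE k Q) :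
    ∑ i, (Q i i).re ≤ k := by
  classical
  have hp : LinearMap.IsProj (LinearMap.range (Matrix.toLin' Q)) (Matrix.toLin' Q) := by
    refine ⟨fun x => LinearMap.mem_range_self _ x, ?_⟩
    rintro _ ⟨x, rfl⟩
    simp [Matrix.mulVec_mulVec, hQ.mul_self]
  have h : Q.trace = (Q.rank : ℂ) := by
    rw [← Matrix.trace_toLin'_eq, hp.trace]; rfl
  have h' : ∑ i, (Q i i).re = (Q.rank : ℝ) := by
    have := congrArg Complex.re h
    simpa [Matrix.trace] using this
  rw [h']
  exact_mod_cast hQ.rank_le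

theorem IsProjOfRankLE.conj [DecidableEq A] {k : ℕ} {Q : Matrix A A ℂ} (hQ : IsProjOfRankLE k Q)
    {U : Matrix A A ℂ} (hU : U ∈ Matrix.unitaryGroup A ℂ) : IsProjOfRankLE k (U * Q * Uᴴ) := by
  have h : Uᴴ * U = 1 := Matrix.mem_unitaryGroup_iff'.1 hU
  refine ⟨?_, ?_, (Matrix.rank_mul_le_left _ _).trans ((Matrix.rank_mul_le_right _ _).trans
    hQ.rank_le)⟩
  · simp [Matrix.conjTranspose_mul, hQ.isHermitian, Matrix.mul_assoc]
  · calc U * Q * Uᴴ * (U * Q * Uᴴ) = U * Q * (Uᴴ * U) * Q * Uᴴ := by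
          simp only [Matrix.mul_assoc]
      _ = U * (Q * Q) * Uᴴ := by rw [h]; simp only [Matrix.mul_assoc, Matrix.mul_one]
      _ = _ := by rw [hQ.mul_self]

theorem frobeniusSq_diagonal_mul [DecidableEq A] {k : ℕ} {Q : Matrix A A ℂ}
    (hQ : IsProjOfRankLE k Q) (d : A → ℝ) :
    frobeniusSq (Matrix.diagonal (fun i => (d i : ℂ)) * Q) = ∑ i, d i ^ 2 * (Q i i).re := by
  rw [frobeniusSq_eq_sum]
  refine Finset.sum_congr rfl fun i _ => ?_
  rw [hQ.diag_eq_normSq, Complex.ofReal_re, Finset.mul_sum]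
  refine Finset.sum_congr rfl fun j _ => ?_
  simp [Matrix.diagonal_mul, sq]

theorem isProjOfRankLE_diagonal_indicator [DecidableEq A] (S : Finset A) :
    IsProjOfRankLE S.card (Matrix.diagonal fun i : A => if i ∈ S then (1 : ℂ) else 0) := by
  refine ⟨?_, ?_, ?_⟩
  · rw [Matrix.diagonal_conjTranspose]
    congr 1; ext i
    by_cases h : i ∈ S <;> simp [h]
  · simp
  · rw [Matrix.rank_diagonal]
    simp

end frobeniusSq

end Matrix

open Matrix

/-! ### Pure states as amplitude matrices. -/

section amplitudes

variable {A B A₁ B₁ : Type}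

/-- The amplitudes of a bipartite pure state, as a matrix. -/
def amplitudeMatrix (v : A × B → ℂ) : Matrix A B ℂ :=
  Matrix.of fun a b => v (a, b)

theorem amplitudeMatrix_injective :
    Function.Injective (amplitudeMatrix : (A × B → ℂ) → Matrix A B ℂ) := by
  intro v w h
  ext ⟨a, b⟩
  exact congrFun (congrFun h a) b

theorem amplitudeMatrix_smul (c : ℂ) (v : A × B → ℂ) :
    amplitudeMatrix (c • v) = c • amplitudeMatrix v := rfl

theorem amplitudeMatrix_kronecker_mulVec [Fintype A] [Fintype B] (M : Matrix A₁ A ℂ)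
    (N : Matrix B₁ B ℂ) (v : A × B → ℂ) :
    amplitudeMatrix ((M ⊗ₖ N) *ᵥ v) = M * amplitudeMatrix v * Nᵀ := by
  ext a b
  simp only [amplitudeMatrix, Matrix.of_apply, Matrix.mulVec, dotProduct, Matrix.mul_apply,
    Fintype.sum_prod_type, Matrix.kroneckerMap_apply, Matrix.transpose_apply, Finset.sum_mul]
  rw [Finset.sum_comm]
  exact Finset.sum_congr rfl fun _ _ => Finset.sum_congr rfl fun _ _ => by ring

theorem mul_pureDensity_mul_conjTranspose {X Y : Type} [Fintype X] (K : Matrix Y X ℂ)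
    (v : X → ℂ) : K * pureDensity v * Kᴴ = pureDensity (K *ᵥ v) := by
  rw [pureDensity, pureDensity, Matrix.mul_vecMulVec, Matrix.vecMulVec_mul, Matrix.star_mulVec]

/-- A pure state is an extreme point: an ensemble which averages to it consists of multiples
of it. -/
theorem exists_smul_of_sum_pureDensity_eq {X ι : Type} [Fintype ι] {u : ι → X → ℂ} {w : X → ℂ}
    (hw : w ≠ 0) (h : ∑ i, pureDensity (u i) = pureDensity w) :
    ∃ c : ι → ℂ, (∀ i, u i = c i • w) ∧ ∑ i, Complex.normSq (c i) = 1 := by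
  have hxy : ∀ x y, ∑ i, u i x * star (u i y) = w x * star (w y) := by
    intro x y
    have := congrFun (congrFun h x) y
    simpa [Matrix.sum_apply, pureDensity, Matrix.vecMulVec_apply] using this
  obtain ⟨x₀, hx₀⟩ := Function.ne_iff.1 hw
  have hx₀ : w x₀ ≠ 0 := hx₀
  -- Proportionality to `w` is the vanishing of these 2 × 2 minors. The sum of their squared moduli
  -- over `i` expands into entries of the averaged density matrix, and with `hxy` the four terms
  -- cancel.
  have hprop : ∀ x i, u i x * w x₀ - u i x₀ * w x = 0 := by
    intro x
    have hsum : ∑ i, Complex.normSq (u i x * w x₀ - u i x₀ * w x) = 0 := by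
      have hc : ((∑ i, Complex.normSq (u i x * w x₀ - u i x₀ * w x) : ℝ) : ℂ) = 0 := by
        push_cast
        have : ∀ i, (Complex.normSq (u i x * w x₀ - u i x₀ * w x) : ℂ) =
            w x₀ * star (w x₀) * (u i x * star (u i x))
            - w x₀ * star (w x) * (u i x * star (u i x₀))
            - w x * star (w x₀) * (u i x₀ * star (u i x))
            + w x * star (w x) * (u i x₀ * star (u i x₀)) := by
          intro i
          rw [← Complex.mul_conj, ← starRingEnd_apply, ← starRingEnd_apply, ← starRingEnd_apply,
            ← starRingEnd_apply, map_sub, map_mul, map_mul]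
          ring
        simp only [this, Finset.sum_add_distrib, Finset.sum_sub_distrib, ← Finset.mul_sum, hxy]
        ring
      exact_mod_cast hc
    intro i
    have := (Finset.sum_eq_zero_iff_of_nonneg (fun i _ => Complex.normSq_nonneg _)).1 hsum i
      (Finset.mem_univ i)
    exact Complex.normSq_eq_zero.1 this
  have hu : ∀ i, u i = (u i x₀ / w x₀) • w := by
    intro i
    ext x
    have := sub_eq_zero.1 (hprop x i)
    simp only [Pi.smul_apply, smul_eq_mul]
    field_simp
    exact this
  refine ⟨fun i => u i x₀ / w x₀, hu, ?_⟩
  have h1 := hxy x₀ x₀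
  have hc : ((∑ i, Complex.normSq (u i x₀ / w x₀) : ℝ) : ℂ) = 1 := by
    push_cast
    have : ∀ i, (Complex.normSq (u i x₀ / w x₀) : ℂ) =
        u i x₀ * star (u i x₀) / (w x₀ * star (w x₀)) := by
      intro i
      rw [Complex.normSq_div, Complex.ofReal_div, ← Complex.mul_conj, ← Complex.mul_conj]
      rfl
    simp only [this, ← Finset.sum_div, h1]
    exact div_self (mul_ne_zero hx₀ (star_ne_zero.2 hx₀))
  exact_mod_cast hc

end amplitudes

/-! ### Monotonicity under LOCC. -/

/-- Every protocol turns a pure state into an ensemble of pure states, and does not decrease the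
weight that projections of rank at most `k` on the second side can capture on average. -/
theorem LOCCProtocol.exists_ensemble {A' B' : Type} [fA : Fintype A'] [fB : Fintype B'] {k : ℕ}
    {A B : Type} (P : LOCCProtocol A' B' A B) :
    ∀ [Fintype A] [Fintype B] (v : A × B → ℂ) (Q : Matrix B B ℂ), IsProjOfRankLE k Q →
      ∃ (ι : Type) (_ : Fintype ι) (u : ι → A' × B' → ℂ) (R : ι → Matrix B' B' ℂ),
        (∀ i, IsProjOfRankLE k (R i)) ∧ P.run (pureDensity v) = ∑ i, pureDensity (u i) ∧
        frobeniusSq (amplitudeMatrix v * Q) ≤ ∑ i, frobeniusSq (amplitudeMatrix (u i) * R i) := by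
  induction P with
  | done =>
    intro iA iB v Q hQ
    obtain rfl : fA = iA := Subsingleton.elim _ _
    obtain rfl : fB = iB := Subsingleton.elim _ _
    exact ⟨Unit, inferInstance, fun _ => v, fun _ => Q, fun _ => hQ, by simp [LOCCProtocol.run],
      by simp⟩
  | @alice A B A₁ iA dA iB dB iA₁ n M hM next ih =>
    intro jA jB v Q hQ
    obtain rfl : iA = jA := Subsingleton.elim _ _
    obtain rfl : iB = jB := Subsingleton.elim _ _
    choose ι fι u R hR hrun hle using fun i => ih i ((M i ⊗ₖ (1 : Matrix B B ℂ)) *ᵥ v) Q hQ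
    refine ⟨Σ i, ι i, inferInstance, fun p => u p.1 p.2, fun p => R p.1 p.2,
      fun p => hR p.1 p.2, ?_, ?_⟩
    · simp only [LOCCProtocol.run, mul_pureDensity_mul_conjTranspose, hrun]
      rw [Fintype.sum_sigma]
    -- The first party acts from the left, so the same `Q` serves all outcomes and the weight is
    -- conserved in this round.
    · rw [Fintype.sum_sigma, ← sum_frobeniusSq_mul M hM]
      refine Finset.sum_le_sum fun i _ => le_trans (le_of_eq ?_) (hle i)
      rw [amplitudeMatrix_kronecker_mulVec, Matrix.transpose_one, Matrix.mul_one,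
        Matrix.mul_assoc]
  | @bob A B B₁ iA dA iB dB iB₁ n M hM next ih =>
    intro jA jB v Q hQ
    obtain rfl : iA = jA := Subsingleton.elim _ _
    obtain rfl : iB = jB := Subsingleton.elim _ _
    -- The measurement now acts on the side of `Q`. So the projection is moved to the first side,
    -- where it commutes with the measurement, and is moved back separately for each outcome.
    obtain ⟨P, hP, hPV⟩ := exists_frobeniusSq_mul_le_left hQ (amplitudeMatrix v)
    choose S hS hSle using fun i =>
      exists_frobeniusSq_mul_le_right hP (amplitudeMatrix v * (M i)ᵀ)
    choose ι fι u R hR hrun hle using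
      fun i => ih i (((1 : Matrix A A ℂ) ⊗ₖ M i) *ᵥ v) (S i) (hS i)
    refine ⟨Σ i, ι i, inferInstance, fun p => u p.1 p.2, fun p => R p.1 p.2,
      fun p => hR p.1 p.2, ?_, ?_⟩
    · simp only [LOCCProtocol.run, mul_pureDensity_mul_conjTranspose, hrun]
      rw [Fintype.sum_sigma]
    · rw [Fintype.sum_sigma]
      refine hPV.trans ?_
      rw [← frobeniusSq_transpose, ← sum_frobeniusSq_mul M hM]
      refine Finset.sum_le_sum fun i _ => ?_
      refine le_trans (le_of_eq ?_) ((hSle i).trans (le_trans (le_of_eq ?_) (hle i)))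
      · rw [← frobeniusSq_transpose, Matrix.transpose_mul, Matrix.transpose_transpose,
          Matrix.mul_assoc]
      · rw [amplitudeMatrix_kronecker_mulVec, Matrix.one_mul]

/-- The Ky Fan type monotones: an upper bound on the weight captured by projections of rank at
most `k` passes from the target to the source of an LOCC conversion. -/
theorem LOCCConvertible.frobeniusSq_mul_le {A B A' B' : Type} [Fintype A] [Fintype B] [Fintype A']
    [Fintype B'] {v : A × B → ℂ} {w : A' × B' → ℂ} (h : LOCCConvertible v w) (hw : w ≠ 0) {k : ℕ}
    {s : ℝ} (hs : ∀ R : Matrix B' B' ℂ, IsProjOfRankLE k R →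
      frobeniusSq (amplitudeMatrix w * R) ≤ s)
    {Q : Matrix B B ℂ} (hQ : IsProjOfRankLE k Q) :
    frobeniusSq (amplitudeMatrix v * Q) ≤ s := by
  obtain ⟨P, hP⟩ := h
  obtain ⟨ι, _, u, R, hR, hrun, hle⟩ := P.exists_ensemble v Q hQ
  obtain ⟨c, hc, hc1⟩ := exists_smul_of_sum_pureDensity_eq hw (hrun.symm.trans hP)
  refine hle.trans ?_
  calc ∑ i, frobeniusSq (amplitudeMatrix (u i) * R i)
      ≤ ∑ i, Complex.normSq (c i) * s := Finset.sum_le_sum fun i _ => by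
        rw [hc i, amplitudeMatrix_smul, Matrix.smul_mul, frobeniusSq_smul]
        exact mul_le_mul_of_nonneg_left (hs _ (hR i)) (Complex.normSq_nonneg _)
    _ = s := by rw [← Finset.sum_mul, hc1, one_mul]

theorem loccConvertible_kronecker_mulVec {A B : Type} [Fintype A] [DecidableEq A] [Fintype B]
    [DecidableEq B] (v : A × B → ℂ) {U : Matrix A A ℂ} (hU : U ∈ unitaryGroup A ℂ)
    {V : Matrix B B ℂ} (hV : V ∈ unitaryGroup B ℂ) : LOCCConvertible v ((U ⊗ₖ V) *ᵥ v) := by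
  refine ⟨.alice (fun _ : Fin 1 => U) (by simpa [← star_eq_conjTranspose] using mem_unitaryGroup_iff'.1 hU) fun _ =>
    .bob (fun _ : Fin 1 => V) (by simpa [← star_eq_conjTranspose] using mem_unitaryGroup_iff'.1 hV) fun _ => .done, ?_⟩
  simp only [LOCCProtocol.run, mul_pureDensity_mul_conjTranspose, Finset.univ_unique,
    Finset.sum_singleton, Matrix.mulVec_mulVec, ← Matrix.mul_kronecker_mul, Matrix.one_mul,
    Matrix.mul_one]

/-! ### Binary entropy and angles. -/

theorem shannonH_eq_binEntropy (x : ℝ) : shannonH x = Real.binEntropy x / Real.log 2 := by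
  rw [shannonH, Real.binEntropy, Real.logb, Real.logb, Real.log_inv, Real.log_inv]
  ring

namespace Real

/-- In the logarithmic variable `log u`, the binary entropy is strictly concave and decreasing
on `[1/2, 1]`, so that spreading two arguments at constant total entropy lowers their product. -/
theorem mul_lt_mul_of_binEntropy_add_eq {u v u' v' : ℝ} (hv' : 1 / 2 ≤ v') (hv : v' < v)
    (hvu : v ≤ u) (hu : u < u') (hu' : u' ≤ 1)
    (h : binEntropy u + binEntropy v = binEntropy u' + binEntropy v') : u' * v' < u * v := by
  have hv'0 : 0 < v' := by linarith
  have hv0 : 0 < v := by linarith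
  have hu0 : 0 < u := by linarith
  have hu'0 : 0 < u' := by linarith
  have hcont : Continuous fun s : ℝ => binEntropy (exp s) :=
    binEntropy_continuous.comp continuous_exp
  have hder : ∀ s : ℝ, s < 0 → HasDerivAt (fun s : ℝ => binEntropy (exp s))
      ((log (1 - exp s) - s) * exp s) s := by
    intro s hs
    have h1 : exp s < 1 := by simpa using hs
    have := (hasDerivAt_binEntropy (exp_ne_zero s) h1.ne).comp s (hasDerivAt_exp s)
    rwa [log_exp] at this
  have l1 : log u < log u' := log_lt_log hu0 hu
  have l2 : log v' < log v := log_lt_log hv'0 hv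
  have l3 : log v ≤ log u := log_le_log hv0 hvu
  have l4 : log u' ≤ 0 := log_nonpos hu'0.le hu'
  have l5 : -log 2 ≤ log v' := by
    have := log_le_log (by norm_num) hv'
    rwa [one_div, log_inv] at this
  -- Mean value theorem on the upper and the lower logarithmic interval. The entropy drop on the
  -- upper one equals the rise on the lower one; since the slope at `c` is steeper, the upper
  -- interval is shorter, which is `hlog`.
  obtain ⟨c, ⟨hc1, hc2⟩, hc⟩ := exists_hasDerivAt_eq_slope (fun s : ℝ => binEntropy (exp s)) _ l1
    hcont.continuousOn (fun s hs => hder s (by linarith [hs.2]))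
  obtain ⟨d, ⟨hd1, hd2⟩, hd⟩ := exists_hasDerivAt_eq_slope (fun s : ℝ => binEntropy (exp s)) _ l2
    hcont.continuousOn (fun s hs => hder s (by linarith [hs.2]))
  simp only [exp_log, hv'0, hv0, hu0, hu'0] at hc hd
  rw [eq_div_iff (by linarith)] at hc hd
  have hc0 : exp c < 1 := by
    have : c < 0 := by linarith
    simpa using this
  have hcd : exp d < exp c := exp_lt_exp.2 (by linarith)
  have hd12 : 1 / 2 < exp d := by
    have : -log 2 < d := by linarith
    calc (1 / 2 : ℝ) = exp (-log 2) := by rw [exp_neg, exp_log (by norm_num)]; norm_num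
      _ < exp d := exp_lt_exp.2 this
  have hdneg : log (1 - exp d) - d < 0 := by
    have h1 : log (1 - exp d) < log (exp d) := log_lt_log (by linarith) (by linarith)
    rw [log_exp] at h1; linarith
  have hclt : log (1 - exp c) - c < log (1 - exp d) - d := by
    have h1 : log (1 - exp c) < log (1 - exp d) := log_lt_log (by linarith) (by linarith)
    linarith
  have hslope : (log (1 - exp c) - c) * exp c < (log (1 - exp d) - d) * exp d := by
    nlinarith [exp_pos d, exp_pos c]
  have hdneg' : (log (1 - exp d) - d) * exp d < 0 := mul_neg_of_neg_of_pos hdneg (exp_pos d)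
  have hlog : log u' + log v' < log u + log v := by
    by_contra hcon
    push Not at hcon
    nlinarith
  rw [← log_mul hu'0.ne' hv'0.ne', ← log_mul hu0.ne' hv0.ne'] at hlog
  exact (log_lt_log_iff (by positivity) (by positivity)).1 hlog

/-- If `y < x'`, then both `x` and `y` lie strictly between `y'` and `x'`, so the product inequality
`h1` contradicts the strict loss under spreading. -/
theorem eq_of_binEntropy_add_eq {x y x' y' : ℝ} (hx : 1 / 2 ≤ x) (hxx : x < x') (hx' : x' ≤ 1)
    (hy' : 1 / 2 ≤ y') (hyy : y' ≤ y) (hy : y ≤ 1)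
    (h : binEntropy x + binEntropy y = binEntropy x' + binEntropy y')
    (h1 : x * y ≤ x' * y') (h2 : y ≤ max x' y') : y = x' := by
  have hanti : binEntropy x' < binEntropy x := by
    refine binEntropy_strictAntiOn ⟨?_, ?_⟩ ⟨?_, ?_⟩ hxx <;> norm_num <;> linarith
  have hyy' : y' < y := by
    refine lt_of_le_of_ne hyy ?_
    rintro rfl
    linarith
  have hyx : y ≤ x' := (le_max_iff.1 h2).resolve_right (not_le.2 hyy')
  refine le_antisymm hyx (not_lt.1 fun hlt => ?_)
  rcases le_total y x with hle | hle
  · exact absurd (mul_lt_mul_of_binEntropy_add_eq hy' hyy' hle hxx hx' h) (not_lt.2 h1)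
  · have hanti2 : binEntropy x' < binEntropy y := by
      refine binEntropy_strictAntiOn ⟨?_, ?_⟩ ⟨?_, ?_⟩ hlt <;> norm_num <;> linarith
    -- Here `y` is the larger inner point, and `y' < x` has to come from the balance: `x'` has less
    -- entropy than `y`, hence `x` has less than `y'`.
    have hxy' : y' < x := by
      by_contra hcon
      have := binEntropy_strictAntiOn.antitoneOn (a := x) (b := y')
        ⟨by norm_num; linarith, by linarith⟩ ⟨by norm_num; linarith, by linarith⟩ (not_lt.1 hcon)
      linarith
    have := mul_lt_mul_of_binEntropy_add_eq hy' hxy' hle hlt hx' (by linarith)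
    linarith [mul_comm x y]

theorem half_le_cos_sq {θ : ℝ} (h0 : 0 ≤ θ) (h1 : θ ≤ π / 4) : 1 / 2 ≤ cos θ ^ 2 := by
  have h : 0 ≤ cos (2 * θ) := cos_nonneg_of_mem_Icc ⟨by linarith [pi_pos], by linarith⟩
  rw [cos_two_mul] at h
  linarith

theorem cos_sq_lt_cos_sq {θ φ : ℝ} (h0 : 0 ≤ θ) (h : θ < φ) (h1 : φ ≤ π / 4) :
    cos φ ^ 2 < cos θ ^ 2 := by
  have h2 : cos φ < cos θ := cos_lt_cos_of_nonneg_of_le_pi_div_two h0 (by linarith [pi_pos]) h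
  have h3 : 0 ≤ cos φ := cos_nonneg_of_mem_Icc ⟨by linarith [pi_pos], by linarith [pi_pos]⟩
  exact pow_lt_pow_left₀ h2 h3 two_ne_zero

theorem eq_of_cos_sq_eq {θ φ : ℝ} (h0 : 0 ≤ θ) (h1 : θ ≤ π / 4) (h0' : 0 ≤ φ) (h1' : φ ≤ π / 4)
    (h : cos θ ^ 2 = cos φ ^ 2) : θ = φ := by
  rcases lt_trichotomy θ φ with hlt | rfl | hlt
  · exact absurd h (cos_sq_lt_cos_sq h0 hlt h1').ne'
  · rfl
  · exact absurd h (cos_sq_lt_cos_sq h0' hlt h1).ne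

end Real

/-! ### Captured weight in terms of singular values. -/

section singularValues

variable {A B : Type} [Fintype A] [DecidableEq A]

theorem frobeniusSq_unitary_mul_diagonal_mul {k : ℕ} {U W Q : Matrix A A ℂ}
    (hU : U ∈ unitaryGroup A ℂ) (hW : W ∈ unitaryGroup A ℂ) (hQ : IsProjOfRankLE k Q)
    (d : A → ℝ) : frobeniusSq (U * diagonal (fun i => (d i : ℂ)) * W * Q) =
      ∑ i, d i ^ 2 * ((W * Q * Wᴴ) i i).re := by
  rw [← frobeniusSq_diagonal_mul (hQ.conj hW), Matrix.mul_assoc, Matrix.mul_assoc,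
    frobeniusSq_isometry_mul U (mem_unitaryGroup_iff'.1 hU)]
  have h := frobeniusSq_isometry_mul W (mem_unitaryGroup_iff'.1 hW)
    (diagonal (fun i => (d i : ℂ)) * (W * Q))ᴴ
  rw [frobeniusSq_conjTranspose, ← frobeniusSq_conjTranspose (W * _), Matrix.conjTranspose_mul,
    Matrix.conjTranspose_conjTranspose] at h
  rw [← h, Matrix.mul_assoc]

theorem exists_frobeniusSq_unitary_mul_diagonal_mul_eq {U W : Matrix A A ℂ}
    (hU : U ∈ unitaryGroup A ℂ) (hW : W ∈ unitaryGroup A ℂ) (d : A → ℝ) (S : Finset A) :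
    ∃ Q : Matrix A A ℂ, IsProjOfRankLE S.card Q ∧
      frobeniusSq (U * diagonal (fun i => (d i : ℂ)) * W * Q) = ∑ i ∈ S, d i ^ 2 := by
  -- The witness is the coordinate projection onto `S`, pulled back through `W`, so that it selects
  -- exactly the singular values indexed by `S`.
  have hD := isProjOfRankLE_diagonal_indicator S
  have hW' : Wᴴ ∈ unitaryGroup A ℂ := Unitary.star_mem hW
  refine ⟨_, hD.conj hW', ?_⟩
  rw [frobeniusSq_unitary_mul_diagonal_mul hU hW (hD.conj hW')]
  have h : W * Wᴴ = 1 := mem_unitaryGroup_iff.1 hW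
  have e : ∀ X : Matrix A A ℂ, W * (Wᴴ * X * Wᴴᴴ) * Wᴴ = X := by
    intro X
    calc W * (Wᴴ * X * Wᴴᴴ) * Wᴴ = (W * Wᴴ) * X * (W * Wᴴ) := by
          simp only [Matrix.mul_assoc, Matrix.conjTranspose_conjTranspose]
      _ = X := by rw [h, Matrix.one_mul, Matrix.mul_one]
  rw [e, ← Finset.sum_filter_add_sum_filter_not Finset.univ (· ∈ S)]
  rw [Finset.sum_congr rfl (g := fun i => d i ^ 2) fun i hi => by
    simp [(Finset.mem_filter.1 hi).2], Finset.sum_eq_zero (s := Finset.univ.filter (· ∉ S))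
    fun i hi => by simp [(Finset.mem_filter.1 hi).2]]
  simp

end singularValues

/-! ### Two-qubit Schmidt states, local unitaries and swaps. -/

namespace QubitBasis

/-- The unitary whose columns are the basis vectors. -/
noncomputable def toMatrix (μ : QubitBasis) : Matrix (Fin 2) (Fin 2) ℂ := Matrix.of fun a i => μ i a

theorem toMatrix_mem_unitaryGroup (μ : QubitBasis) : μ.toMatrix ∈ unitaryGroup (Fin 2) ℂ := by
  rw [mem_unitaryGroup_iff']
  ext i j
  have h := orthonormal_iff_ite.1 μ.orthonormal i j
  rw [PiLp.inner_apply] at h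
  simp only [RCLike.inner_apply] at h
  rw [star_eq_conjTranspose, Matrix.mul_apply, Matrix.one_apply, ← h]
  exact Finset.sum_congr rfl fun a _ => mul_comm _ _

end QubitBasis

theorem transpose_mem_unitaryGroup {A : Type} [Fintype A] [DecidableEq A] {U : Matrix A A ℂ}
    (hU : U ∈ unitaryGroup A ℂ) : Uᵀ ∈ unitaryGroup A ℂ := by
  rw [mem_unitaryGroup_iff]
  have h : Uᴴ * U = 1 := mem_unitaryGroup_iff'.1 hU
  have : star Uᵀ = (Uᴴ)ᵀ := rfl
  rw [this, ← Matrix.transpose_mul, h, Matrix.transpose_one]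

theorem amplitudeMatrix_schmidtState (θ : ℝ) (μ ν : QubitBasis) :
    amplitudeMatrix (schmidtState θ μ ν) = μ.toMatrix *
      diagonal (fun i => ((![Real.cos θ, Real.sin θ] i : ℝ) : ℂ)) * ν.toMatrixᵀ := by
  ext a b
  simp [amplitudeMatrix, schmidtState, QubitBasis.toMatrix, Matrix.mul_apply, Fin.sum_univ_two,
    Matrix.diagonal]
  ring

theorem amplitudeMatrix_jointState {A B a b : Type} (ψ : A × B → ℂ) (φ : a × b → ℂ) :
    amplitudeMatrix (jointState ψ φ) = amplitudeMatrix ψ ⊗ₖ amplitudeMatrix φ := rfl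

theorem amplitudeMatrix_jointState_schmidtState (θ φ : ℝ) (μ ν ξ η : QubitBasis) :
    amplitudeMatrix (jointState (schmidtState θ μ ν) (schmidtState φ ξ η)) =
      (μ.toMatrix ⊗ₖ ξ.toMatrix) * diagonal (fun i => ((![Real.cos θ, Real.sin θ] i.1 *
        ![Real.cos φ, Real.sin φ] i.2 : ℝ) : ℂ)) * (ν.toMatrix ⊗ₖ η.toMatrix)ᵀ := by
  rw [amplitudeMatrix_jointState, amplitudeMatrix_schmidtState, amplitudeMatrix_schmidtState,
    Matrix.mul_kronecker_mul, Matrix.mul_kronecker_mul, Matrix.diagonal_kronecker_diagonal,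
    Matrix.kroneckerMap_transpose]
  simp only [Complex.ofReal_mul]

theorem schmidtState_eq_mulVec (θ : ℝ) (μ ν μ' ν' : QubitBasis) :
    schmidtState θ μ' ν' = ((μ'.toMatrix * μ.toMatrixᴴ) ⊗ₖ (ν'.toMatrix * ν.toMatrixᴴ)) *ᵥ
      schmidtState θ μ ν := by
  apply amplitudeMatrix_injective
  have h : μ.toMatrixᴴ * μ.toMatrix = 1 := mem_unitaryGroup_iff'.1 μ.toMatrix_mem_unitaryGroup
  have h' : ν.toMatrixᵀ * ν.toMatrixᴴᵀ = 1 := by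
    rw [← Matrix.transpose_mul, ← Matrix.transpose_one]
    exact congrArg _ (mem_unitaryGroup_iff'.1 ν.toMatrix_mem_unitaryGroup)
  rw [amplitudeMatrix_kronecker_mulVec, amplitudeMatrix_schmidtState, amplitudeMatrix_schmidtState,
    Matrix.transpose_mul]
  generalize (diagonal _ : Matrix (Fin 2) (Fin 2) ℂ) = D
  calc μ'.toMatrix * D * ν'.toMatrixᵀ
      = μ'.toMatrix * (μ.toMatrixᴴ * μ.toMatrix) * D * (ν.toMatrixᵀ * ν.toMatrixᴴᵀ) *
        ν'.toMatrixᵀ := by rw [h, h', Matrix.mul_one, Matrix.mul_one]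
    _ = _ := by simp only [Matrix.mul_assoc]

theorem jointState_mulVec {A B a b : Type} [Fintype A] [Fintype B] [Fintype a] [Fintype b]
    (U₁ : Matrix A A ℂ) (V₁ : Matrix B B ℂ) (U₂ : Matrix a a ℂ) (V₂ : Matrix b b ℂ)
    (ψ : A × B → ℂ) (φ : a × b → ℂ) :
    jointState ((U₁ ⊗ₖ V₁) *ᵥ ψ) ((U₂ ⊗ₖ V₂) *ᵥ φ) =
      ((U₁ ⊗ₖ U₂) ⊗ₖ (V₁ ⊗ₖ V₂)) *ᵥ jointState ψ φ := by
  apply amplitudeMatrix_injective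
  rw [amplitudeMatrix_kronecker_mulVec, amplitudeMatrix_jointState, amplitudeMatrix_jointState,
    amplitudeMatrix_kronecker_mulVec, amplitudeMatrix_kronecker_mulVec, Matrix.mul_kronecker_mul,
    Matrix.mul_kronecker_mul, Matrix.kroneckerMap_transpose]

theorem localSwap_jointState {P Q : Type} (ψ φ : P × Q → ℂ) :
    localSwap (jointState ψ φ) = jointState φ ψ := by
  ext x
  simp [localSwap, jointState, mul_comm]

/-- Each party's swap is a permutation matrix, hence unitary; this is what makes the swap an LOCC
operation. -/
theorem exists_localSwap_eq_mulVec {P Q : Type} [Fintype P] [DecidableEq P] [Fintype Q]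
    [DecidableEq Q] : ∃ S ∈ unitaryGroup (P × P) ℂ, ∃ T ∈ unitaryGroup (Q × Q) ℂ,
      ∀ v : (P × P) × (Q × Q) → ℂ, localSwap v = (S ⊗ₖ T) *ᵥ v := by
  have key : ∀ R : Type, [Fintype R] → [DecidableEq R] →
      ((1 : Matrix (R × R) (R × R) ℂ).submatrix (Equiv.prodComm R R) id) ∈
        unitaryGroup (R × R) ℂ := by
    intro R _ _
    rw [mem_unitaryGroup_iff, star_eq_conjTranspose, Matrix.conjTranspose_submatrix,
      Matrix.conjTranspose_one]
    exact (Matrix.submatrix_mul_equiv (1 : Matrix (R × R) (R × R) ℂ) 1 (Equiv.prodComm R R)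
      (Equiv.refl _) (Equiv.prodComm R R)).trans (by
        rw [Matrix.one_mul, Matrix.submatrix_one_equiv])
  refine ⟨_, key P, _, key Q, fun v => ?_⟩
  apply amplitudeMatrix_injective
  rw [amplitudeMatrix_kronecker_mulVec]
  ext x y
  simp [amplitudeMatrix, localSwap, Matrix.mul_apply, Matrix.one_apply]

/-- The reduced state is `V * Vᴴ`. The second basis cancels inside this product, and the first by
cyclicity of the characteristic polynomial. -/
theorem entanglement_schmidtState (θ : ℝ) (μ ν μ' ν' : QubitBasis) :
    entanglement (schmidtState θ μ ν) = entanglement (schmidtState θ μ' ν') := by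
  have hred : ∀ v : Fin 2 × Fin 2 → ℂ,
      reducedState (pureDensity v) = amplitudeMatrix v * (amplitudeMatrix v)ᴴ := by
    intro v
    ext a a'
    simp [reducedState, pureDensity, amplitudeMatrix, Matrix.mul_apply, Matrix.vecMulVec_apply]
  have hchar : ∀ μ ν : QubitBasis, (reducedState (pureDensity (schmidtState θ μ ν))).charpoly =
      (diagonal (fun i => ((![Real.cos θ, Real.sin θ] i : ℝ) : ℂ)) *
        (diagonal (fun i => ((![Real.cos θ, Real.sin θ] i : ℝ) : ℂ)))ᴴ).charpoly := by
    intro μ ν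
    rw [hred, amplitudeMatrix_schmidtState]
    generalize (diagonal _ : Matrix (Fin 2) (Fin 2) ℂ) = D
    have h : μ.toMatrixᴴ * μ.toMatrix = 1 := mem_unitaryGroup_iff'.1 μ.toMatrix_mem_unitaryGroup
    have h' : ν.toMatrixᵀ * (ν.toMatrixᵀ)ᴴ = 1 :=
      mem_unitaryGroup_iff.1 (transpose_mem_unitaryGroup ν.toMatrix_mem_unitaryGroup)
    have e : μ.toMatrix * D * ν.toMatrixᵀ * (μ.toMatrix * D * ν.toMatrixᵀ)ᴴ =
        μ.toMatrix * (D * (ν.toMatrixᵀ * (ν.toMatrixᵀ)ᴴ) * Dᴴ * μ.toMatrixᴴ) := by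
      simp only [Matrix.conjTranspose_mul, Matrix.mul_assoc]
    rw [e, h', Matrix.charpoly_mul_comm, Matrix.mul_assoc, h, Matrix.mul_one, Matrix.mul_one]
  simp only [entanglement, vonNeumannEntropy, hchar]

/-! ### Majorization and the main theorem. -/

/-- The first two majorization inequalities for the squared Schmidt coefficients of products of
two-qubit states. -/
theorem LOCCConvertible.cos_sq_majorized {β α β' α' : ℝ} {μ ν ξ η μ' ν' ξ' η' : QubitBasis}
    (h : LOCCConvertible (jointState (schmidtState β μ ν) (schmidtState α ξ η))
      (jointState (schmidtState β' μ' ν') (schmidtState α' ξ' η')))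
    (hβ' : 1 / 2 ≤ Real.cos β' ^ 2) (hα' : 1 / 2 ≤ Real.cos α' ^ 2) :
    Real.cos β ^ 2 * Real.cos α ^ 2 ≤ Real.cos β' ^ 2 * Real.cos α' ^ 2 ∧
      Real.cos α ^ 2 ≤ max (Real.cos β' ^ 2) (Real.cos α' ^ 2) := by
  have hU : ∀ μ ξ : QubitBasis, μ.toMatrix ⊗ₖ ξ.toMatrix ∈ unitaryGroup (Fin 2 × Fin 2) ℂ :=
    fun μ ξ => Matrix.kronecker_mem_unitary μ.toMatrix_mem_unitaryGroup
      ξ.toMatrix_mem_unitaryGroup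
  have hlow := fun (β α : ℝ) (μ ν ξ η : QubitBasis) (S : Finset (Fin 2 × Fin 2)) => by
    have := exists_frobeniusSq_unitary_mul_diagonal_mul_eq (hU μ ξ)
      (transpose_mem_unitaryGroup (hU ν η)) (fun i => ![Real.cos β, Real.sin β] i.1 *
        ![Real.cos α, Real.sin α] i.2) S
    rwa [← amplitudeMatrix_jointState_schmidtState] at this
  have hw : jointState (schmidtState β' μ' ν') (schmidtState α' ξ' η') ≠ 0 := by
    intro h0
    obtain ⟨Q, -, hQ⟩ := hlow β' α' μ' ν' ξ' η' {(0, 0)}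
    have hz : amplitudeMatrix (0 : (Fin 2 × Fin 2) × (Fin 2 × Fin 2) → ℂ) = 0 := rfl
    rw [h0, hz, Matrix.zero_mul] at hQ
    simp [frobeniusSq, mul_pow] at hQ
    rcases hQ with hQ | hQ
    · rw [hQ] at hβ'; norm_num at hβ'
    · rw [hQ] at hα'; norm_num at hα'
  -- The `p i` are the diagonal entries of `R` in the Schmidt basis. Bounding the weight becomes a
  -- linear program over `0 ≤ p i ≤ 1` with total at most `k`.
  have hup : ∀ {k : ℕ} (R : Matrix (Fin 2 × Fin 2) (Fin 2 × Fin 2) ℂ), IsProjOfRankLE k R →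
      ∃ p : Fin 2 × Fin 2 → ℝ, (∀ i, 0 ≤ p i) ∧ (∀ i, p i ≤ 1) ∧
        p (0, 0) + p (0, 1) + p (1, 0) + p (1, 1) ≤ k ∧
        frobeniusSq (amplitudeMatrix (jointState (schmidtState β' μ' ν')
          (schmidtState α' ξ' η')) * R) =
          Real.cos β' ^ 2 * Real.cos α' ^ 2 * p (0, 0) +
          Real.cos β' ^ 2 * (1 - Real.cos α' ^ 2) * p (0, 1) +
          (1 - Real.cos β' ^ 2) * Real.cos α' ^ 2 * p (1, 0) +
          (1 - Real.cos β' ^ 2) * (1 - Real.cos α' ^ 2) * p (1, 1) := by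
    intro k R hR
    have hT := transpose_mem_unitaryGroup (hU ν' η')
    have hC := hR.conj hT
    refine ⟨_, hC.diag_nonneg, hC.diag_le_one, ?_, ?_⟩
    · have := hC.sum_diag_le
      simp only [Fintype.sum_prod_type, Fin.sum_univ_two] at this
      linarith
    · rw [amplitudeMatrix_jointState_schmidtState,
        frobeniusSq_unitary_mul_diagonal_mul (hU μ' ξ') hT hR]
      simp only [Fintype.sum_prod_type, Fin.sum_univ_two, Matrix.cons_val_zero,
        Matrix.cons_val_one, mul_pow, Real.sin_sq]
      ring
  have hβ1 : Real.cos β' ^ 2 ≤ 1 := Real.cos_sq_le_one β'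
  have hα1 : Real.cos α' ^ 2 ≤ 1 := Real.cos_sq_le_one α'
  generalize hX : Real.cos β' ^ 2 = X at *
  generalize hY : Real.cos α' ^ 2 = Y at *
  constructor
  · obtain ⟨Q, hQ, hQe⟩ := hlow β α μ ν ξ η {(0, 0)}
    have hle := h.frobeniusSq_mul_le hw (k := 1) (s := X * Y) (fun R hR => by
      obtain ⟨p, h0, -, hs, he⟩ := hup R hR
      rw [he]
      push_cast at hs
      have e1 : X * (1 - Y) ≤ X * Y := mul_le_mul_of_nonneg_left (by linarith) (by linarith)
      have e2 : (1 - X) * Y ≤ X * Y := mul_le_mul_of_nonneg_right (by linarith) (by linarith)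
      have e3 : (1 - X) * (1 - Y) ≤ X * Y :=
        mul_le_mul (by linarith) (by linarith) (by linarith) (by linarith)
      have e0 : 0 ≤ X * Y := mul_nonneg (by linarith) (by linarith)
      linarith [mul_le_mul_of_nonneg_right e1 (h0 (0, 1)),
        mul_le_mul_of_nonneg_right e2 (h0 (1, 0)), mul_le_mul_of_nonneg_right e3 (h0 (1, 1)),
        mul_le_mul_of_nonneg_left hs e0]) hQ
    rw [hQe] at hle
    simpa [mul_pow] using hle
  -- These two coefficients sum to cos² α, because cos² β + sin² β = 1.
  · obtain ⟨Q, hQ, hQe⟩ := hlow β α μ ν ξ η {(0, 0), (1, 0)}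
    have hle := h.frobeniusSq_mul_le hw (k := 2) (s := max X Y) (fun R hR => by
      obtain ⟨p, h0, h1, hs, he⟩ := hup R hR
      rw [he]
      push_cast at hs
      have e3 : (1 - X) * (1 - Y) ≤ X * (1 - Y) :=
        mul_le_mul_of_nonneg_right (by linarith) (by linarith)
      have e3' : (1 - X) * (1 - Y) ≤ (1 - X) * Y :=
        mul_le_mul_of_nonneg_left (by linarith) (by linarith)
      have f1 : X * (1 - Y) ≤ X * Y := mul_le_mul_of_nonneg_left (by linarith) (by linarith)
      have f2 : (1 - X) * Y ≤ X * Y := mul_le_mul_of_nonneg_right (by linarith) (by linarith)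
      -- The largest coefficient is `X * Y`; the runner-up is `X * (1 - Y)` or `(1 - X) * Y`,
      -- according to the order of `X` and `Y`. The top two add up to `X` or `Y` respectively.
      rcases le_total Y X with hle | hle
      · refine le_trans ?_ (le_max_left X Y)
        have e2 : (1 - X) * Y ≤ X * (1 - Y) := by linarith
        have e0 : 0 ≤ X * (1 - Y) := mul_nonneg (by linarith) (by linarith)
        linarith [mul_le_mul_of_nonneg_right e2 (h0 (1, 0)),
          mul_le_mul_of_nonneg_right e3 (h0 (1, 1)), mul_le_mul_of_nonneg_left hs e0,
          mul_le_mul_of_nonneg_left (h1 (0, 0)) (sub_nonneg.2 f1)]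
      · refine le_trans ?_ (le_max_right X Y)
        have e2 : X * (1 - Y) ≤ (1 - X) * Y := by linarith
        have e0 : 0 ≤ (1 - X) * Y := mul_nonneg (by linarith) (by linarith)
        linarith [mul_le_mul_of_nonneg_right e2 (h0 (0, 1)),
          mul_le_mul_of_nonneg_right e3' (h0 (1, 1)), mul_le_mul_of_nonneg_left hs e0,
          mul_le_mul_of_nonneg_left (h1 (0, 0)) (sub_nonneg.2 f2)]) hQ
    rw [hQe] at hle
    simp [mul_pow, Real.sin_sq] at hle
    rw [le_max_iff]
    rcases hle with hle | hle
    · left; linarith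
    · right; linarith

theorem mainTheorem3 (α β Δα Δβ : ℝ)
    (hα : 0 ≤ α) (hβ : β ≤ Real.pi / 4)
    (hΔβ : 0 < Δβ) (hΔβ' : Δβ ≤ β)
    (hΔα : 0 ≤ Δα) (hΔα' : α + Δα ≤ Real.pi / 4)
    (hbalance : shannonH (Real.cos β ^ 2) + shannonH (Real.cos α ^ 2) =
      shannonH (Real.cos (β - Δβ) ^ 2) + shannonH (Real.cos (α + Δα) ^ 2))
    (μ ν ξ η μ' ν' ξ' η' : QubitBasis) :
    (LOCCConvertible
        (jointState (schmidtState β μ ν) (schmidtState α ξ η))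
        (jointState (schmidtState (β - Δβ) μ' ν') (schmidtState (α + Δα) ξ' η')) ↔
      α = β - Δβ) ∧
    (α = β - Δβ →
      Δα = Δβ ∧
      entanglement (schmidtState β μ ν) - entanglement (schmidtState (β - Δβ) μ' ν') =
        entanglement (schmidtState β μ ν) - entanglement (schmidtState α ξ η) ∧
      entanglement (schmidtState (α + Δα) ξ' η') - entanglement (schmidtState α ξ η) =
        entanglement (schmidtState β μ ν) - entanglement (schmidtState α ξ η) ∧
      localSwap (jointState (schmidtState β μ ν) (schmidtState α ξ η)) =
        jointState (schmidtState (β - Δβ) ξ η) (schmidtState (α + Δα) μ ν) ∧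
      ∃ U₁ ∈ Matrix.unitaryGroup (Fin 2) ℂ, ∃ U₂ ∈ Matrix.unitaryGroup (Fin 2) ℂ,
      ∃ V₁ ∈ Matrix.unitaryGroup (Fin 2) ℂ, ∃ V₂ ∈ Matrix.unitaryGroup (Fin 2) ℂ,
        jointState (schmidtState (β - Δβ) μ' ν') (schmidtState (α + Δα) ξ' η') =
          ((U₁ ⊗ₖ U₂) ⊗ₖ (V₁ ⊗ₖ V₂)).mulVec
            (localSwap (jointState (schmidtState β μ ν) (schmidtState α ξ η)))) := by
  have hbal : Real.binEntropy (Real.cos β ^ 2) + Real.binEntropy (Real.cos α ^ 2) =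
      Real.binEntropy (Real.cos (β - Δβ) ^ 2) + Real.binEntropy (Real.cos (α + Δα) ^ 2) := by
    simp only [shannonH_eq_binEntropy, ← add_div] at hbalance
    exact (div_left_inj' (Real.log_pos one_lt_two).ne').1 hbalance
  have hβhalf := Real.half_le_cos_sq (θ := β) (by linarith) hβ
  have hβ'half := Real.half_le_cos_sq (θ := β - Δβ) (by linarith) (by linarith)
  have hα'half := Real.half_le_cos_sq (θ := α + Δα) (by linarith) hΔα'
  have hangle : α = β - Δβ → α + Δα = β := by
    intro h
    refine Real.eq_of_cos_sq_eq (by linarith) hΔα' (by linarith) hβ ?_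
    rw [← h] at hbal
    -- With α = β - Δβ, one entropy term cancels from each side of the balance.
    have hinj := Real.binEntropy_strictAntiOn.injOn
    refine hinj ⟨by norm_num; linarith, Real.cos_sq_le_one _⟩
      ⟨by norm_num; linarith, Real.cos_sq_le_one _⟩ ?_
    linarith
  have hswap : α = β - Δβ →
      localSwap (jointState (schmidtState β μ ν) (schmidtState α ξ η)) =
        jointState (schmidtState (β - Δβ) ξ η) (schmidtState (α + Δα) μ ν) := by
    intro h
    rw [localSwap_jointState, hangle h, ← h]
  have hunit : ∀ μ μ' : QubitBasis, μ'.toMatrix * μ.toMatrixᴴ ∈ unitaryGroup (Fin 2) ℂ :=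
    fun μ μ' => mul_mem μ'.toMatrix_mem_unitaryGroup
      (Unitary.star_mem μ.toMatrix_mem_unitaryGroup)
  have htarget : α = β - Δβ →
      jointState (schmidtState (β - Δβ) μ' ν') (schmidtState (α + Δα) ξ' η') =
        (((μ'.toMatrix * ξ.toMatrixᴴ) ⊗ₖ (ξ'.toMatrix * μ.toMatrixᴴ)) ⊗ₖ
          ((ν'.toMatrix * η.toMatrixᴴ) ⊗ₖ (η'.toMatrix * ν.toMatrixᴴ))) *ᵥ
          (localSwap (jointState (schmidtState β μ ν) (schmidtState α ξ η))) := by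
    intro h
    rw [hswap h, schmidtState_eq_mulVec (β - Δβ) ξ η μ' ν',
      schmidtState_eq_mulVec (α + Δα) μ ν ξ' η', jointState_mulVec]
  refine ⟨⟨fun h => ?_, fun h => ?_⟩, fun h => ⟨?_, ?_, ?_, hswap h, ?_⟩⟩
  · obtain ⟨h1, h2⟩ := h.cos_sq_majorized hβ'half hα'half
    have hlt := Real.cos_sq_lt_cos_sq (θ := β - Δβ) (φ := β) (by linarith) (by linarith) hβ
    have hle : Real.cos (α + Δα) ^ 2 ≤ Real.cos α ^ 2 := by
      rcases hΔα.eq_or_lt with h0 | h0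
      · rw [← h0, add_zero]
      · exact (Real.cos_sq_lt_cos_sq hα (by linarith) hΔα').le
    exact Real.eq_of_cos_sq_eq hα (by linarith) (by linarith) (by linarith)
      (Real.eq_of_binEntropy_add_eq hβhalf hlt (Real.cos_sq_le_one _) hα'half hle
        (Real.cos_sq_le_one _) hbal h1 h2)
  -- Swap and basis change compose to one unitary per party, a protocol without any genuine
  -- measurement.
  · obtain ⟨S, hS, T, hT, hST⟩ := exists_localSwap_eq_mulVec (P := Fin 2) (Q := Fin 2)
    rw [htarget h, hST, Matrix.mulVec_mulVec, ← Matrix.mul_kronecker_mul]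
    exact loccConvertible_kronecker_mulVec _
      (mul_mem (Matrix.kronecker_mem_unitary (hunit _ _) (hunit _ _)) hS)
      (mul_mem (Matrix.kronecker_mem_unitary (hunit _ _) (hunit _ _)) hT)
  · linarith [hangle h]
  · rw [← h, entanglement_schmidtState α μ' ν' ξ η]
  · rw [hangle h, entanglement_schmidtState β ξ' η' μ ν]
  · exact ⟨_, hunit _ _, _, hunit _ _, _, hunit _ _, _, hunit _ _, htarget h⟩
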